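/- Let $c\in(0,1)$. For a function $f:\mathbb{N}_0\to\mathbb{R}$ (in particular for the restriction to $\mathbb{N}_0$ of a real polynomial) put $$\|f\|_{c,1}:=\Big(\sum_{k=0}^{\infty}c^k f(k)^2\Big)^{1/2},\qquad \Delta f(x):=f(x+1)-f(x).$$ Let $\mathcal{P}_n$ be the set of real polynomials of degree at most $n$, and let $$\gamma_n(c,1):=\sup\{\|\Delta f\|_{c,1}\,:\,f\in\mathcal{P}_n,\ \|f\|_{c,1}=1\}.$$ Then for every integer $n\ge 2$, $\gamma_n(c,1)$ is the best (i.e. the smallest possible) constant $\gamma$ in the Markov-Bernstein inequality $$\|\Delta p\|_{c,1}\le\gamma\,\|p\|_{c,1}\quad\text{for all }p\in\mathcal{P}_n,$$ and it satisfies $$\frac{1+\frac{1}{\sqrt c}}{\Big(1+\frac{4\sqrt c}{(1-\sqrt c)^2}\sin^2\frac{\pi}{2n}\Big)^{1/2}}\ \le\ \gamma_n(c,1)\ \le\ \frac{1+\frac{1}{\sqrt c}}{\Big(1+\frac{2\sqrt c}{(1-\sqrt c)^2\,n(n+1)}\Big)^{1/2}}.$$ -/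

import Mathlib

open Polynomial

noncomputable section

/-- The Meixner weight `(β)_k / k! * c ^ k`, where `(β)_k = β (β + 1) ⋯ (β + k - 1)`. -/
def meixnerWeight (c β : ℝ) (k : ℕ) : ℝ :=
  (ascPochhammer ℝ k).eval β / (k.factorial : ℝ) * c ^ k

/-- The Meixner inner product of two real sequences. -/
def meixnerInner (c β : ℝ) (f g : ℕ → ℝ) : ℝ :=
  ∑' k : ℕ, meixnerWeight c β k * f k * g k

/-- The Meixner norm of a real sequence. -/
def meixnerNorm (c β : ℝ) (f : ℕ → ℝ) : ℝ :=
  Real.sqrt (meixnerInner c β f f)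

/-- The sequence `p(0), p(1), p(2), …` of values of a real polynomial. -/
def polySeq (p : ℝ[X]) : ℕ → ℝ := fun k => p.eval (k : ℝ)

/-- The best Markov-Bernstein constant `γ_n(c, β)`: the supremum of `‖Δ p‖` over the real
polynomials `p` of degree at most `n` with `‖p‖ = 1`, where `Δ f (x) = f (x + 1) - f x`. -/
def markovBernsteinConst (n : ℕ) (c β : ℝ) : ℝ :=
  sSup {r : ℝ | ∃ p : ℝ[X], p.natDegree ≤ n ∧ meixnerNorm c β (polySeq p) = 1 ∧
    r = meixnerNorm c β (fwdDiff 1 (polySeq p))}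

/-- The forward difference of the sequence of values of a polynomial. -/
theorem fwdDiff_polySeq (p : ℝ[X]) :
    fwdDiff 1 (polySeq p) = polySeq (p.comp (X + 1) - p) := by
  funext k
  simp [fwdDiff, polySeq]

theorem meixnerWeight_pos {c β : ℝ} (hc : 0 < c) (hβ : 0 < β) (k : ℕ) :
    0 < meixnerWeight c β k := by
  have h := ascPochhammer_pos k β hβ
  unfold meixnerWeight
  positivity

theorem meixnerWeight_succ (c β : ℝ) (k : ℕ) :
    meixnerWeight c β (k + 1) = meixnerWeight c β k * ((β + k) / (k + 1) * c) := by
  unfold meixnerWeight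
  rw [ascPochhammer_succ_eval, Nat.factorial_succ, pow_succ]
  have h1 : (k.factorial : ℝ) ≠ 0 := by positivity
  have h2 : (k + 1 : ℝ) ≠ 0 := by positivity
  push_cast
  field_simp

theorem summable_meixnerWeight_mul_pow {c β : ℝ} (hc : c ∈ Set.Ioo (0 : ℝ) 1) (hβ : 0 < β)
    (m : ℕ) : Summable fun k : ℕ => meixnerWeight c β k * (k : ℝ) ^ m := by
  refine summable_of_ratio_test_tendsto_lt_one (l := c) hc.2 ?_ ?_
  · filter_upwards [Filter.eventually_gt_atTop 0] with k hk
    have h := meixnerWeight_pos hc.1 hβ k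
    positivity
  · have hinv : Filter.Tendsto (fun k : ℕ => ((k : ℝ))⁻¹) Filter.atTop (nhds 0) :=
      tendsto_inv_atTop_nhds_zero_nat
    have hlim : Filter.Tendsto
        (fun k : ℕ => (β * (k : ℝ)⁻¹ + 1) / (1 + (k : ℝ)⁻¹) * c * (1 + (k : ℝ)⁻¹) ^ m)
        Filter.atTop (nhds ((β * 0 + 1) / (1 + 0) * c * (1 + 0) ^ m)) := by
      refine Filter.Tendsto.mul (Filter.Tendsto.mul (Filter.Tendsto.div ?_ ?_ ?_) ?_) ?_
      · exact (hinv.const_mul β).add_const 1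
      · exact hinv.const_add 1
      · norm_num
      · exact tendsto_const_nhds
      · exact (hinv.const_add 1).pow m
    have hval : (β * 0 + 1) / (1 + 0) * c * (1 + 0) ^ m = c := by simp
    rw [hval] at hlim
    refine hlim.congr' ?_
    filter_upwards [Filter.eventually_gt_atTop 0] with k hk
    have hw := meixnerWeight_pos hc.1 hβ k
    have hc0 := hc.1
    have hk' : (0 : ℝ) < k := by exact_mod_cast hk
    rw [meixnerWeight_succ, Real.norm_of_nonneg (by positivity),
      Real.norm_of_nonneg (by positivity)]
    have h1 : (1 + (k : ℝ)⁻¹) = (k + 1) / k := by field_simp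
    rw [h1, div_pow]
    push_cast
    field_simp

/-- On polynomials the series that defines the Meixner inner product converges. -/
theorem summable_meixnerInner_polySeq {c β : ℝ} (hc : c ∈ Set.Ioo (0 : ℝ) 1) (hβ : 0 < β)
    (p q : ℝ[X]) :
    Summable fun k : ℕ => meixnerWeight c β k * polySeq p k * polySeq q k := by
  have h : ∀ r : ℝ[X], Summable fun k : ℕ => meixnerWeight c β k * r.eval (k : ℝ) := by
    intro r
    simp only [Polynomial.eval_eq_sum_range, Finset.mul_sum]
    refine summable_sum fun i _ => ?_
    refine ((summable_meixnerWeight_mul_pow hc hβ i).mul_left (r.coeff i)).congr fun k => ?_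
    ring
  refine (h (p * q)).congr fun k => ?_
  simp [polySeq, mul_assoc]

end

noncomputable section

/-! Put `s = √c`. The rescaled Meixner polynomials `M_n` are orthogonal with common squared norm `1
/ (1 - s ^ 2)` and satisfy `ΔM_{n+1} = s ΔM_n + (s - s⁻¹) M_n`. Give `p` the coefficients `b, e_0 -
s e_1, …, e_{n-1} - s e_n` with `e_n = 0`; summation by parts yields `Δp = (s - s⁻¹) ∑ e_j M_j`. The
optimum therefore has `b = 0` and is governed by the minimum of `∑ (e_j - s e_{j+1}) ^ 2` over `∑
e_j ^ 2`. The numerator equals `(1 - s) ^ 2 ∑ e_j ^ 2 + s (1 - s) e_0 ^ 2 + s ∑ (e_j - e_{j+1}) ^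
2`. A discrete Poincaré inequality (`sum_sq_le_mul_sum_sq_sub_succ`) bounds it below and gives the
upper estimate; the trial sequence `e_j = sin (jπ/n)` (`sum_sq_sin_sub_mul_succ`) gives the lower
one. -/

theorem meixnerWeight_one (c : ℝ) (k : ℕ) : meixnerWeight c 1 k = c ^ k := by
  unfold meixnerWeight
  rw [ascPochhammer_eval_one, div_self (by positivity), one_mul]

/-- The Meixner inner product with `β = 1` as a bilinear form on real polynomials. -/
def meixnerForm (c : ℝ) (hc : c ∈ Set.Ioo (0 : ℝ) 1) : ℝ[X] →ₗ[ℝ] ℝ[X] →ₗ[ℝ] ℝ :=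
  have hsum := summable_meixnerInner_polySeq hc one_pos
  LinearMap.mk₂ ℝ (fun p q => meixnerInner c 1 (polySeq p) (polySeq q))
    (fun p p' q => by
      unfold meixnerInner
      rw [← (hsum p q).tsum_add (hsum p' q)]
      exact tsum_congr fun k => by simp only [polySeq, eval_add]; ring)
    (fun a p q => by
      unfold meixnerInner
      rw [smul_eq_mul, ← tsum_mul_left]
      exact tsum_congr fun k => by simp only [polySeq, eval_smul, smul_eq_mul]; ring)
    (fun p q q' => by
      unfold meixnerInner
      rw [← (hsum p q).tsum_add (hsum p q')]
      exact tsum_congr fun k => by simp only [polySeq, eval_add]; ring)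
    (fun a p q => by
      unfold meixnerInner
      rw [smul_eq_mul, ← tsum_mul_left]
      exact tsum_congr fun k => by simp only [polySeq, eval_smul, smul_eq_mul]; ring)

theorem meixnerForm_apply (c : ℝ) (hc : c ∈ Set.Ioo (0 : ℝ) 1) (p q : ℝ[X]) :
    meixnerForm c hc p q = meixnerInner c 1 (polySeq p) (polySeq q) := rfl

theorem meixnerForm_comm (c : ℝ) (hc : c ∈ Set.Ioo (0 : ℝ) 1) (p q : ℝ[X]) :
    meixnerForm c hc p q = meixnerForm c hc q p := by
  simp only [meixnerForm_apply, meixnerInner]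
  exact tsum_congr fun k => by ring

theorem meixnerForm_self_nonneg (c : ℝ) (hc : c ∈ Set.Ioo (0 : ℝ) 1) (p : ℝ[X]) :
    0 ≤ meixnerForm c hc p p := by
  rw [meixnerForm_apply]
  refine tsum_nonneg fun k => ?_
  rw [mul_assoc]
  exact mul_nonneg (meixnerWeight_pos hc.1 one_pos k).le (mul_self_nonneg _)

/-- Splits off the term `k = 0`; with geometric weights the tail is `c` times the same form.
Orthogonality rests on this alone. -/
theorem meixnerForm_shift (c : ℝ) (hc : c ∈ Set.Ioo (0 : ℝ) 1) (p q : ℝ[X]) :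
    meixnerForm c hc p q = p.eval 0 * q.eval 0 +
      c * meixnerForm c hc (p.comp (X + 1)) (q.comp (X + 1)) := by
  simp only [meixnerForm_apply, meixnerInner]
  rw [(summable_meixnerInner_polySeq hc one_pos p q).tsum_eq_zero_add, ← tsum_mul_left]
  congr 1
  · simp [meixnerWeight_one, polySeq]
  · refine tsum_congr fun k => ?_
    simp only [meixnerWeight_one, polySeq, eval_comp, eval_add, eval_X, eval_one]
    push_cast
    ring

theorem meixnerNorm_polySeq (c : ℝ) (hc : c ∈ Set.Ioo (0 : ℝ) 1) (p : ℝ[X]) :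
    meixnerNorm c 1 (polySeq p) = √(meixnerForm c hc p p) := rfl

theorem meixnerNorm_fwdDiff_polySeq (c : ℝ) (hc : c ∈ Set.Ioo (0 : ℝ) 1) (p : ℝ[X]) :
    meixnerNorm c 1 (fwdDiff 1 (polySeq p)) =
      √(meixnerForm c hc (p.comp (X + 1) - p) (p.comp (X + 1) - p)) := by
  rw [fwdDiff_polySeq, meixnerNorm_polySeq c hc]

/-! ### Meixner polynomials: recurrence and orthogonality -/

theorem polynomial_eq_of_eval_natCast {p q : ℝ[X]}
    (h : ∀ k : ℕ, p.eval (k : ℝ) = q.eval (k : ℝ)) : p = q := by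
  refine Polynomial.eq_of_infinite_eval_eq p q ?_
  refine (Set.infinite_range_of_injective (Nat.cast_injective (R := ℝ))).mono ?_
  rintro _ ⟨k, rfl⟩
  exact h k

/-- The polynomial `x (x - 1) ⋯ (x - k + 1) / k!`. -/
def binomialPoly (k : ℕ) : ℝ[X] := C ((k.factorial : ℝ)⁻¹) * descPochhammer ℝ k

theorem degree_binomialPoly (k : ℕ) : (binomialPoly k).degree = k := by
  have h : ((k.factorial : ℝ)⁻¹) ≠ 0 := by positivity
  rw [binomialPoly, degree_C_mul h,
    degree_eq_natDegree (monic_descPochhammer ℝ k).ne_zero, descPochhammer_natDegree]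

theorem eval_natCast_binomialPoly (k x : ℕ) :
    (binomialPoly k).eval (x : ℝ) = (x.choose k : ℝ) := by
  rw [Nat.cast_choose_eq_descPochhammer_div, binomialPoly, eval_mul, eval_C]
  ring

/-- The Meixner polynomials with `β = 1` and `c = s ^ 2`, scaled so that all of them have the
same norm. -/
def scaledMeixner (s : ℝ) (n : ℕ) : ℝ[X] :=
  ∑ k ∈ Finset.range (n + 1), C (s ^ n * n.choose k * (1 - 1 / s ^ 2) ^ k) * binomialPoly k

theorem degree_scaledMeixner {s : ℝ} (hs : s ∈ Set.Ioo (0 : ℝ) 1) (n : ℕ) :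
    (scaledMeixner s n).degree = n := by
  have h1 : 1 - 1 / s ^ 2 ≠ 0 := by
    have h0 := hs.1.ne'
    have : s ^ 2 < 1 := by nlinarith [hs.1, hs.2]
    have h2 : 1 < 1 / s ^ 2 := (one_lt_div (by positivity)).2 this
    exact (by linarith : 1 - 1 / s ^ 2 < 0).ne
  have h2 : s ^ n * n.choose n * (1 - 1 / s ^ 2) ^ n ≠ 0 := by
    have h0 := hs.1.ne'
    rw [Nat.choose_self, Nat.cast_one, mul_one]
    positivity
  have h3 : (C (s ^ n * n.choose n * (1 - 1 / s ^ 2) ^ n) * binomialPoly n).degree =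
      (n : WithBot ℕ) := by
    rw [degree_C_mul h2, degree_binomialPoly]
  rw [scaledMeixner, Finset.sum_range_succ, degree_add_eq_right_of_degree_lt, h3]
  rw [h3]
  refine (degree_sum_le _ _).trans_lt ((Finset.sup_lt_iff (WithBot.bot_lt_coe n)).2 fun k hk => ?_)
  rw [← smul_eq_C_mul]
  refine (degree_smul_le _ _).trans_lt ?_
  rw [degree_binomialPoly]
  exact Nat.cast_lt.2 (Finset.mem_range.1 hk)

theorem eval_natCast_scaledMeixner (s : ℝ) (n x : ℕ) :
    (scaledMeixner s n).eval (x : ℝ) =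
      s ^ n * ∑ k ∈ Finset.range (n + 1), (n.choose k : ℝ) * x.choose k * (1 - 1 / s ^ 2) ^ k := by
  rw [scaledMeixner, eval_finsetSum, Finset.mul_sum]
  refine Finset.sum_congr rfl fun k _ => ?_
  rw [eval_mul, eval_C, eval_natCast_binomialPoly]
  ring

/-- By Pascal's rule in both arguments, the mixed difference of `C(n,k+1) C(x,k+1)` is `C(n,k)
C(x,k)`. -/
theorem sum_choose_mul_choose_mixed_diff (a : ℝ) (n x : ℕ) :
    (∑ k ∈ Finset.range (n + 2), ((n + 1).choose k : ℝ) * (x + 1).choose k * a ^ k)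
      - ∑ k ∈ Finset.range (n + 1), (n.choose k : ℝ) * (x + 1).choose k * a ^ k =
    (∑ k ∈ Finset.range (n + 2), ((n + 1).choose k : ℝ) * x.choose k * a ^ k)
      - (∑ k ∈ Finset.range (n + 1), (n.choose k : ℝ) * x.choose k * a ^ k)
      + a * ∑ k ∈ Finset.range (n + 1), (n.choose k : ℝ) * x.choose k * a ^ k := by
  have ext (y : ℕ) : ∑ k ∈ Finset.range (n + 1), (n.choose k : ℝ) * y.choose k * a ^ k =
      ∑ k ∈ Finset.range (n + 2), (n.choose k : ℝ) * y.choose k * a ^ k := by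
    rw [Finset.sum_range_succ _ (n + 1)]
    simp
  rw [ext (x + 1), Finset.mul_sum]
  nth_rw 1 [ext x]
  simp only [Finset.sum_range_succ' _ (n + 1)]
  rw [← sub_eq_zero]
  have key : ∑ k ∈ Finset.range (n + 1),
      ((((n + 1).choose (k + 1) : ℝ) * (x + 1).choose (k + 1) * a ^ (k + 1)
        - (n.choose (k + 1) : ℝ) * (x + 1).choose (k + 1) * a ^ (k + 1))
        - ((((n + 1).choose (k + 1) : ℝ) * x.choose (k + 1) * a ^ (k + 1)
        - (n.choose (k + 1) : ℝ) * x.choose (k + 1) * a ^ (k + 1))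
        + a * ((n.choose k : ℝ) * x.choose k * a ^ k))) = 0 := by
    refine Finset.sum_eq_zero fun k _ => ?_
    rw [Nat.choose_succ_succ' n k, Nat.choose_succ_succ' x k]
    push_cast
    ring
  simp only [Finset.sum_sub_distrib, Finset.sum_add_distrib] at key
  simp only [Nat.choose_zero_right, Nat.cast_one, pow_zero]
  linarith

theorem scaledMeixner_zero (s : ℝ) : scaledMeixner s 0 = 1 := by
  simp [scaledMeixner, binomialPoly]

theorem eval_zero_scaledMeixner (s : ℝ) (n : ℕ) : (scaledMeixner s n).eval 0 = s ^ n := by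
  have h := eval_natCast_scaledMeixner s n 0
  rw [Finset.sum_range_succ'] at h
  simpa using h

theorem scaledMeixner_succ_comp {s : ℝ} (hs : s ≠ 0) (n : ℕ) :
    (scaledMeixner s (n + 1)).comp (X + 1) - s • (scaledMeixner s n).comp (X + 1) =
      scaledMeixner s (n + 1) - s⁻¹ • scaledMeixner s n := by
  refine polynomial_eq_of_eval_natCast fun x => ?_
  have h := sum_choose_mul_choose_mixed_diff (1 - 1 / s ^ 2) n x
  have hx : ((x : ℝ) + 1) = ((x + 1 : ℕ) : ℝ) := by push_cast; ring
  simp only [eval_sub, eval_smul, eval_comp, eval_add, eval_X, eval_one, smul_eq_mul]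
  rw [hx]
  simp only [eval_natCast_scaledMeixner]
  have h' : s⁻¹ * s ^ n = s ^ (n + 1) * (1 / s ^ 2) := by
    rw [pow_succ]
    field_simp
  rw [← mul_assoc s⁻¹, h']
  linear_combination s ^ (n + 1) * h

theorem sq_mem_Ioo {s : ℝ} (hs : s ∈ Set.Ioo (0 : ℝ) 1) : s ^ 2 ∈ Set.Ioo (0 : ℝ) 1 :=
  ⟨pow_pos hs.1 2, by nlinarith [hs.1, hs.2]⟩

/-- `M_{n+1} - s M_n` vanishes at `0`, and its shift is `M_{n+1} - s⁻¹ M_n`. In the shift identity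
for two such polynomials the mixed products cancel because `s ^ 2 * s⁻¹ = s`, so the Gram matrix is
constant along diagonals; only its first row remains to be found. -/
theorem meixnerForm_scaledMeixner {s : ℝ} (hs : s ∈ Set.Ioo (0 : ℝ) 1) (m n : ℕ) :
    meixnerForm (s ^ 2) (sq_mem_Ioo hs) (scaledMeixner s m) (scaledMeixner s n) =
      if m = n then 1 / (1 - s ^ 2) else 0 := by
  have hc := sq_mem_Ioo hs
  have h0 := hs.1.ne'
  have h1 : 1 - s ^ 2 ≠ 0 := by linarith [hc.2]
  have hz : meixnerForm (s ^ 2) hc 1 1 = 1 / (1 - s ^ 2) := by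
    have h := meixnerForm_shift (s ^ 2) hc 1 1
    simp only [one_comp, eval_one] at h
    field_simp
    linarith
  have hl (n : ℕ) : meixnerForm (s ^ 2) hc 1 (scaledMeixner s (n + 1)) = 0 := by
    have h := meixnerForm_shift (s ^ 2) hc 1 (scaledMeixner s (n + 1) - s • scaledMeixner s n)
    simp only [sub_comp, smul_comp, scaledMeixner_succ_comp h0, one_comp, eval_sub, eval_smul,
      eval_one, eval_zero_scaledMeixner, map_sub, map_smul, smul_eq_mul] at h
    have h2 : s ^ 2 * s⁻¹ = s := by field_simp
    have : (1 - s ^ 2) * meixnerForm (s ^ 2) hc 1 (scaledMeixner s (n + 1)) = 0 := by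
      linear_combination h - meixnerForm (s ^ 2) hc 1 (scaledMeixner s n) * h2
    exact (mul_eq_zero.1 this).resolve_left h1
  have hr (m n : ℕ) :
      meixnerForm (s ^ 2) hc (scaledMeixner s (m + 1)) (scaledMeixner s (n + 1)) =
        meixnerForm (s ^ 2) hc (scaledMeixner s m) (scaledMeixner s n) := by
    have h := meixnerForm_shift (s ^ 2) hc (scaledMeixner s (m + 1) - s • scaledMeixner s m)
      (scaledMeixner s (n + 1) - s • scaledMeixner s n)
    simp only [sub_comp, smul_comp, scaledMeixner_succ_comp h0, eval_sub, eval_smul,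
      eval_zero_scaledMeixner, map_sub, map_smul, smul_eq_mul, LinearMap.sub_apply,
      LinearMap.smul_apply] at h
    have h2 : s ^ 2 * s⁻¹ = s := by field_simp
    have h3 : s ^ 2 * s⁻¹ * s⁻¹ = 1 := by field_simp
    rw [← sub_eq_zero]
    refine (mul_eq_zero.1 ?_).resolve_left h1
    linear_combination h
      + meixnerForm (s ^ 2) hc (scaledMeixner s m) (scaledMeixner s n) * h3
      - (meixnerForm (s ^ 2) hc (scaledMeixner s (m + 1)) (scaledMeixner s n)
        + meixnerForm (s ^ 2) hc (scaledMeixner s m) (scaledMeixner s (n + 1))) * h2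
  induction m generalizing n with
  | zero =>
    rw [scaledMeixner_zero]
    cases n with
    | zero => rw [scaledMeixner_zero, hz, if_pos rfl]
    | succ n => rw [hl, if_neg (by omega)]
  | succ m ih =>
    cases n with
    | zero => rw [scaledMeixner_zero, meixnerForm_comm, hl, if_neg (by omega)]
    | succ n => rw [hr, ih]; simp

theorem meixnerForm_sum_scaledMeixner {s : ℝ} (hs : s ∈ Set.Ioo (0 : ℝ) 1) (n : ℕ)
    (a : ℕ → ℝ) :
    meixnerForm (s ^ 2) (sq_mem_Ioo hs) (∑ k ∈ Finset.range n, a k • scaledMeixner s k)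
      (∑ k ∈ Finset.range n, a k • scaledMeixner s k) =
      (∑ k ∈ Finset.range n, a k ^ 2) / (1 - s ^ 2) := by
  simp only [map_sum, LinearMap.sum_apply, map_smul, LinearMap.smul_apply, smul_eq_mul,
    meixnerForm_scaledMeixner hs]
  rw [Finset.sum_div]
  refine Finset.sum_congr rfl fun k hk => ?_
  rw [Finset.sum_eq_single k]
  · rw [if_pos rfl]; ring
  · intro j _ hj
    simp [hj]
  · exact fun h => absurd hk h

/-! ### Meixner coefficients of a polynomial and of its difference -/

theorem exists_eq_sum_scaledMeixner {s : ℝ} (hs : s ∈ Set.Ioo (0 : ℝ) 1) {n : ℕ} {p : ℝ[X]}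
    (hp : p.natDegree ≤ n) :
    ∃ a : ℕ → ℝ, p = ∑ k ∈ Finset.range (n + 1), a k • scaledMeixner s k := by
  let S : Polynomial.Sequence ℝ := ⟨scaledMeixner s, degree_scaledMeixner hs⟩
  have hspan := S.span_degreeLT (m := n + 1)
    (fun i _ => (leadingCoeff_ne_zero.2 (S.ne_zero i)).isUnit)
  have hmem : p ∈ degreeLT ℝ (n + 1) := by
    rw [mem_degreeLT]
    exact degree_le_natDegree.trans_lt (by exact_mod_cast Nat.lt_succ_of_le hp)
  rw [← hspan, ← Finset.coe_range] at hmem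
  obtain ⟨a, ha⟩ := (Submodule.mem_span_image_finset_iff_exists_fun' ℝ).1 hmem
  exact ⟨a, ha.symm⟩

/-- Back substitution in a bidiagonal system, starting from `e n = 0`. -/
theorem exists_eq_sub_mul_succ (s : ℝ) (n : ℕ) (a : ℕ → ℝ) :
    ∃ e : ℕ → ℝ, e n = 0 ∧ ∀ j < n, a j = e j - s * e (j + 1) := by
  induction n generalizing a with
  | zero => exact ⟨0, rfl, by simp⟩
  | succ n ih =>
    obtain ⟨e, he, h⟩ := ih fun j => a (j + 1)
    refine ⟨fun j => j.casesOn (a 0 + s * e 0) e, he, fun j hj => ?_⟩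
    cases j with
    | zero => simp
    | succ j => exact h j (by omega)

/-- The polynomial with the Meixner coefficients `b, e 0 - s * e 1, e 1 - s * e 2, …`. -/
def meixnerCombination (s : ℝ) (n : ℕ) (b : ℝ) (e : ℕ → ℝ) : ℝ[X] :=
  (∑ j ∈ Finset.range n, (e j - s * e (j + 1)) • scaledMeixner s (j + 1))
    + b • scaledMeixner s 0

theorem natDegree_scaledMeixner {s : ℝ} (hs : s ∈ Set.Ioo (0 : ℝ) 1) (n : ℕ) :
    (scaledMeixner s n).natDegree = n :=
  natDegree_eq_of_degree_eq_some (degree_scaledMeixner hs n)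

theorem natDegree_meixnerCombination_le {s : ℝ} (hs : s ∈ Set.Ioo (0 : ℝ) 1) (n : ℕ) (b : ℝ)
    (e : ℕ → ℝ) : (meixnerCombination s n b e).natDegree ≤ n := by
  refine natDegree_add_le_of_degree_le (natDegree_sum_le_of_forall_le _ _ fun k hk =>
    (natDegree_smul_le _ _).trans ?_) ((natDegree_smul_le _ _).trans ?_)
  · rw [natDegree_scaledMeixner hs]
    exact Finset.mem_range.1 hk
  · rw [natDegree_scaledMeixner hs]
    exact Nat.zero_le n

theorem exists_eq_meixnerCombination {s : ℝ} (hs : s ∈ Set.Ioo (0 : ℝ) 1) {n : ℕ} {p : ℝ[X]}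
    (hp : p.natDegree ≤ n) :
    ∃ (b : ℝ) (e : ℕ → ℝ), e n = 0 ∧ p = meixnerCombination s n b e := by
  obtain ⟨a, rfl⟩ := exists_eq_sum_scaledMeixner hs hp
  obtain ⟨e, he, h⟩ := exists_eq_sub_mul_succ s n fun j => a (j + 1)
  refine ⟨a 0, e, he, ?_⟩
  rw [meixnerCombination, Finset.sum_range_succ']
  congr 1
  exact Finset.sum_congr rfl fun j hj => by rw [← h j (Finset.mem_range.1 hj)]

theorem meixnerForm_meixnerCombination {s : ℝ} (hs : s ∈ Set.Ioo (0 : ℝ) 1) (n : ℕ) (b : ℝ)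
    (e : ℕ → ℝ) :
    meixnerForm (s ^ 2) (sq_mem_Ioo hs) (meixnerCombination s n b e)
      (meixnerCombination s n b e) =
      (b ^ 2 + ∑ j ∈ Finset.range n, (e j - s * e (j + 1)) ^ 2) / (1 - s ^ 2) := by
  have h := meixnerForm_sum_scaledMeixner hs (n + 1)
    (fun k => if k = 0 then b else e (k - 1) - s * e k)
  simp only [Finset.sum_range_succ', Nat.add_eq_zero_iff, one_ne_zero, and_false, if_false,
    if_true, Nat.add_sub_cancel] at h
  rw [meixnerCombination, h, add_comm (b ^ 2)]

theorem meixnerCombination_comp_sub {s : ℝ} (hs : s ≠ 0) {n : ℕ} (b : ℝ) {e : ℕ → ℝ}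
    (he : e n = 0) :
    (meixnerCombination s n b e).comp (X + 1) - meixnerCombination s n b e =
      ∑ j ∈ Finset.range n, ((s - s⁻¹) * e j) • scaledMeixner s j := by
  have h0 : (scaledMeixner s 0).comp (X + 1) = scaledMeixner s 0 := by
    rw [scaledMeixner_zero, one_comp]
  have hrec (j : ℕ) : (scaledMeixner s (j + 1)).comp (X + 1) - scaledMeixner s (j + 1) =
      s • ((scaledMeixner s j).comp (X + 1) - scaledMeixner s j)
        + (s - s⁻¹) • scaledMeixner s j := by
    have h := scaledMeixner_succ_comp hs j
    rw [sub_eq_sub_iff_add_eq_add] at h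
    rw [sub_eq_iff_eq_add, smul_sub, sub_smul]
    rw [← eq_sub_iff_add_eq] at h
    rw [h]
    abel
  -- Summation by parts: the boundary terms vanish since `ΔM_0 = 0` and `e n = 0`.
  have htel := Finset.sum_range_sub
    (fun j => (s * e j) • ((scaledMeixner s j).comp (X + 1) - scaledMeixner s j)) n
  rw [he, h0, sub_self, smul_zero, mul_zero, zero_smul, sub_zero] at htel
  have hcomp : (meixnerCombination s n b e).comp (X + 1) - meixnerCombination s n b e =
      ∑ j ∈ Finset.range n, (e j - s * e (j + 1)) •
        ((scaledMeixner s (j + 1)).comp (X + 1) - scaledMeixner s (j + 1)) := by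
    simp only [meixnerCombination, add_comp, Polynomial.sum_comp, smul_comp, h0, smul_sub,
      Finset.sum_sub_distrib]
    abel
  rw [hcomp, ← add_zero (Finset.sum _ _), ← htel, ← Finset.sum_add_distrib]
  refine Finset.sum_congr rfl fun j _ => ?_
  rw [← add_sub_assoc, ← add_smul, sub_add_cancel, hrec, smul_add, smul_smul, smul_smul,
    mul_comm (e j) s, mul_comm (e j) (s - s⁻¹)]
  abel

theorem meixnerForm_meixnerCombination_comp_sub {s : ℝ} (hs : s ∈ Set.Ioo (0 : ℝ) 1) {n : ℕ}
    (b : ℝ) {e : ℕ → ℝ} (he : e n = 0) :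
    meixnerForm (s ^ 2) (sq_mem_Ioo hs)
      ((meixnerCombination s n b e).comp (X + 1) - meixnerCombination s n b e)
      ((meixnerCombination s n b e).comp (X + 1) - meixnerCombination s n b e) =
      (s - s⁻¹) ^ 2 * (∑ j ∈ Finset.range n, e j ^ 2) / (1 - s ^ 2) := by
  rw [meixnerCombination_comp_sub hs.1.ne' b he, meixnerForm_sum_scaledMeixner hs]
  simp only [mul_pow, Finset.mul_sum]

/-! ### Estimates for the quadratic form -/

/-- Each `e_j` is a telescoping sum of `n - j` differences, so Cauchy-Schwarz costs a factor `n -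
j`; these add up to `n (n + 1) / 2`. -/
theorem sum_sq_le_mul_sum_sq_sub_succ {n : ℕ} {e : ℕ → ℝ} (he : e n = 0) :
    ∑ j ∈ Finset.range n, e j ^ 2 ≤
      (n : ℝ) * (n + 1) / 2 * ∑ j ∈ Finset.range n, (e j - e (j + 1)) ^ 2 := by
  induction n generalizing e with
  | zero => simp
  | succ n ih =>
    have h := ih (e := fun j => e (j + 1)) he
    have h0 : e 0 ^ 2 ≤ (n + 1 : ℝ) * ∑ j ∈ Finset.range (n + 1), (e j - e (j + 1)) ^ 2 := by
      have ht : e 0 = ∑ j ∈ Finset.range (n + 1), (e j - e (j + 1)) := by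
        rw [Finset.sum_range_sub', he, sub_zero]
      have hq := sq_sum_le_card_mul_sum_sq (s := Finset.range (n + 1))
        (f := fun j => e j - e (j + 1))
      rw [← ht, Finset.card_range] at hq
      exact_mod_cast hq
    have h1 : ∑ j ∈ Finset.range n, (e (j + 1) - e (j + 1 + 1)) ^ 2 ≤
        ∑ j ∈ Finset.range (n + 1), (e j - e (j + 1)) ^ 2 := by
      rw [Finset.sum_range_succ']
      exact le_add_of_nonneg_right (sq_nonneg _)
    have h2 := mul_le_mul_of_nonneg_left h1 (by positivity : (0 : ℝ) ≤ n * (n + 1) / 2)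
    rw [Finset.sum_range_succ']
    push_cast
    linarith

theorem mul_sum_sq_le_sum_sq_sub_mul_succ {s : ℝ} (hs : s ∈ Set.Ioo (0 : ℝ) 1) {n : ℕ}
    (hn : 0 < n) {e : ℕ → ℝ} (he : e n = 0) :
    ((1 - s) ^ 2 + 2 * s / (n * (n + 1))) * ∑ j ∈ Finset.range n, e j ^ 2 ≤
      ∑ j ∈ Finset.range n, (e j - s * e (j + 1)) ^ 2 := by
  have hn' : (0 : ℝ) < n := by exact_mod_cast hn
  have htel := Finset.sum_range_sub (fun j => e j ^ 2) n
  simp only [he] at htel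
  have hexp : ∑ j ∈ Finset.range n, (e j - s * e (j + 1)) ^ 2 =
      (1 - s) ^ 2 * ∑ j ∈ Finset.range n, e j ^ 2
        - s * (1 - s) * ∑ j ∈ Finset.range n, (e (j + 1) ^ 2 - e j ^ 2)
        + s * ∑ j ∈ Finset.range n, (e j - e (j + 1)) ^ 2 := by
    simp only [Finset.mul_sum]
    rw [← Finset.sum_sub_distrib, ← Finset.sum_add_distrib]
    exact Finset.sum_congr rfl fun j _ => by ring
  have hD : 2 * s / (n * (n + 1)) * ∑ j ∈ Finset.range n, e j ^ 2 ≤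
      s * ∑ j ∈ Finset.range n, (e j - e (j + 1)) ^ 2 := by
    have h := mul_le_mul_of_nonneg_left (sum_sq_le_mul_sum_sq_sub_succ he)
      (div_nonneg (by linarith [hs.1]) (by positivity) : 0 ≤ 2 * s / (n * (n + 1)))
    refine h.trans_eq ?_
    field_simp
  -- The boundary term left by telescoping; it is discarded.
  have h0 : 0 ≤ s * (1 - s) * e 0 ^ 2 :=
    mul_nonneg (mul_nonneg hs.1.le (by linarith [hs.2])) (sq_nonneg _)
  rw [hexp, htel]
  linarith

/-- The sines vanish at both ends and form an eigenvector of the discrete Dirichlet Laplacian, with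
eigenvalue `4 sin² (π/(2n))`. -/
theorem sum_sq_sin_sub_mul_succ (s : ℝ) {n : ℕ} (hn : 0 < n) :
    ∑ j ∈ Finset.range n, (Real.sin (j * (Real.pi / n))
        - s * Real.sin ((j + 1 : ℕ) * (Real.pi / n))) ^ 2 =
      ((1 - s) ^ 2 + 4 * s * Real.sin (Real.pi / (2 * n)) ^ 2) *
        ∑ j ∈ Finset.range n, Real.sin (j * (Real.pi / n)) ^ 2 := by
  have hn' : (n : ℝ) ≠ 0 := by exact_mod_cast hn.ne'
  have hlast : Real.sin (n * (Real.pi / n)) = 0 := by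
    rw [mul_div_cancel₀ _ hn', Real.sin_pi]
  have hcos : Real.cos (Real.pi / n) = 1 - 2 * Real.sin (Real.pi / (2 * n)) ^ 2 := by
    rw [show Real.pi / n = 2 * (Real.pi / (2 * n)) by field_simp, Real.cos_two_mul,
      Real.cos_sq']
    ring
  have ht1 := Finset.sum_range_sub (fun j : ℕ => Real.sin (j * (Real.pi / n)) ^ 2) n
  -- The predecessor's angle is written as a real difference, which avoids truncated subtraction at
  -- `j = 0`.
  have ht2 := Finset.sum_range_sub (fun j : ℕ => Real.sin (j * (Real.pi / n)) *
    Real.sin (j * (Real.pi / n) - Real.pi / n)) n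
  simp only [hlast, Nat.cast_zero, zero_mul, Real.sin_zero, ne_eq, OfNat.ofNat_ne_zero,
    not_false_eq_true, zero_pow, sub_zero] at ht1 ht2
  calc _ = ((1 - s) ^ 2 + 4 * s * Real.sin (Real.pi / (2 * n)) ^ 2) *
        ∑ j ∈ Finset.range n, Real.sin (j * (Real.pi / n)) ^ 2
        + s ^ 2 * ∑ j ∈ Finset.range n, (Real.sin ((j + 1 : ℕ) * (Real.pi / n)) ^ 2
          - Real.sin (j * (Real.pi / n)) ^ 2)
        - s * ∑ j ∈ Finset.range n, (Real.sin ((j + 1 : ℕ) * (Real.pi / n)) *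
          Real.sin ((j + 1 : ℕ) * (Real.pi / n) - Real.pi / n)
          - Real.sin (j * (Real.pi / n)) * Real.sin (j * (Real.pi / n) - Real.pi / n)) := by
        simp only [Finset.mul_sum]
        rw [← Finset.sum_add_distrib, ← Finset.sum_sub_distrib]
        refine Finset.sum_congr rfl fun j _ => ?_
        have h1 : ((j + 1 : ℕ) : ℝ) * (Real.pi / n) = j * (Real.pi / n) + Real.pi / n := by
          push_cast; ring
        rw [h1, add_sub_cancel_right, Real.sin_add, Real.sin_sub, hcos]
        ring
    _ = _ := by rw [ht1, ht2]; ring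

/-- The square of the constant `(1 + 1/√c) / √(1 + y / (1 - √c)²)`, in terms of `s = √c`. -/
theorem sq_markovConst {s : ℝ} (hs : s ∈ Set.Ioo (0 : ℝ) 1) {y : ℝ} (hy : 0 ≤ y) :
    ((1 + 1 / s) / √(1 + y / (1 - s) ^ 2)) ^ 2 * ((1 - s) ^ 2 + y) = (s - s⁻¹) ^ 2 := by
  have h0 := hs.1.ne'
  have h1 : 1 - s ≠ 0 := by linarith [hs.2]
  have h2 : 0 < (1 - s) ^ 2 + y := by positivity
  rw [div_pow, Real.sq_sqrt (by positivity)]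
  have h3 : 1 + y / (1 - s) ^ 2 = ((1 - s) ^ 2 + y) / (1 - s) ^ 2 := by field_simp
  rw [h3]
  field_simp
  ring

/-! ### The two bounds for the norm of the difference -/

theorem meixnerNorm_fwdDiff_le {s : ℝ} (hs : s ∈ Set.Ioo (0 : ℝ) 1) {n : ℕ} (hn : 0 < n)
    {p : ℝ[X]} (hp : p.natDegree ≤ n) :
    meixnerNorm (s ^ 2) 1 (fwdDiff 1 (polySeq p)) ≤
      (1 + 1 / s) / √(1 + 2 * s / (n * (n + 1)) / (1 - s) ^ 2) *
        meixnerNorm (s ^ 2) 1 (polySeq p) := by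
  obtain ⟨b, e, he, rfl⟩ := exists_eq_meixnerCombination hs hp
  have hs0 := hs.1
  have hK := sq_markovConst hs (y := 2 * s / (n * (n + 1))) (by positivity)
  set K := (1 + 1 / s) / √(1 + 2 * s / (n * (n + 1)) / (1 - s) ^ 2) with hKdef
  have hK0 : 0 ≤ K := by positivity
  have h1 : 0 < 1 - s ^ 2 := by linarith [(sq_mem_Ioo hs).2]
  rw [meixnerNorm_fwdDiff_polySeq _ (sq_mem_Ioo hs), meixnerNorm_polySeq _ (sq_mem_Ioo hs)]
  refine Real.sqrt_le_iff.2 ⟨by positivity, ?_⟩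
  rw [mul_pow, Real.sq_sqrt (meixnerForm_self_nonneg _ _ _),
    meixnerForm_meixnerCombination_comp_sub hs b he, meixnerForm_meixnerCombination hs, ← hK,
    ← mul_div_assoc, mul_assoc]
  gcongr
  exact (mul_sum_sq_le_sum_sq_sub_mul_succ hs hn he).trans
    (le_add_of_nonneg_left (sq_nonneg b))

theorem exists_le_meixnerNorm_fwdDiff {s : ℝ} (hs : s ∈ Set.Ioo (0 : ℝ) 1) {n : ℕ} (hn : 2 ≤ n) :
    ∃ p : ℝ[X], p.natDegree ≤ n ∧ 0 < meixnerNorm (s ^ 2) 1 (polySeq p) ∧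
      (1 + 1 / s) / √(1 + 4 * s * Real.sin (Real.pi / (2 * n)) ^ 2 / (1 - s) ^ 2) *
        meixnerNorm (s ^ 2) 1 (polySeq p) ≤ meixnerNorm (s ^ 2) 1 (fwdDiff 1 (polySeq p)) := by
  have hs0 := hs.1
  have hn' : (n : ℝ) ≠ 0 := by positivity
  have hn2 : (2 : ℝ) ≤ n := by exact_mod_cast hn
  have h1 : 0 < 1 - s ^ 2 := by linarith [(sq_mem_Ioo hs).2]
  have h2 : 0 < 1 - s := by linarith [hs.2]
  obtain ⟨e, hdef⟩ : ∃ e : ℕ → ℝ, ∀ j : ℕ, Real.sin (j * (Real.pi / n)) = e j := ⟨_, fun _ => rfl⟩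
  have he : e n = 0 := by rw [← hdef, mul_div_cancel₀ _ hn', Real.sin_pi]
  have hquad := sum_sq_sin_sub_mul_succ s (by omega : 0 < n)
  simp only [hdef] at hquad
  have hsum : 0 < ∑ j ∈ Finset.range n, e j ^ 2 := by
    -- Here `n ≥ 2` is essential: for `n = 1` the trial sequence is zero.
    have he1 : 0 < e 1 := by
      rw [← hdef]
      refine Real.sin_pos_of_pos_of_lt_pi (by positivity) ?_
      rw [Nat.cast_one, one_mul]
      exact div_lt_self Real.pi_pos (by linarith)
    exact Finset.sum_pos' (fun j _ => sq_nonneg _)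
      ⟨1, Finset.mem_range.2 (by omega), by positivity⟩
  have hK := sq_markovConst hs (y := 4 * s * Real.sin (Real.pi / (2 * n)) ^ 2) (by positivity)
  have hform := meixnerForm_meixnerCombination hs n 0 e
  rw [hquad, zero_pow two_ne_zero, zero_add] at hform
  refine ⟨meixnerCombination s n 0 e, natDegree_meixnerCombination_le hs n 0 e, ?_, ?_⟩
  · rw [meixnerNorm_polySeq _ (sq_mem_Ioo hs), Real.sqrt_pos, hform]
    positivity
  · rw [meixnerNorm_fwdDiff_polySeq _ (sq_mem_Ioo hs), meixnerNorm_polySeq _ (sq_mem_Ioo hs)]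
    refine Real.le_sqrt_of_sq_le ?_
    rw [mul_pow, Real.sq_sqrt (meixnerForm_self_nonneg _ _ _),
      meixnerForm_meixnerCombination_comp_sub hs 0 he, hform, ← hK, ← mul_div_assoc,
      mul_assoc (_ ^ 2)]

/-! ### The supremum as the best constant -/

theorem meixnerNorm_smul {c : ℝ} (f : ℕ → ℝ) (a : ℝ) :
    meixnerNorm c 1 (a • f) = |a| * meixnerNorm c 1 f := by
  have h : meixnerInner c 1 (a • f) (a • f) = a ^ 2 * meixnerInner c 1 f f := by
    unfold meixnerInner
    rw [← tsum_mul_left]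
    exact tsum_congr fun k => by simp only [Pi.smul_apply, smul_eq_mul]; ring
  rw [meixnerNorm, h, Real.sqrt_mul (sq_nonneg a), Real.sqrt_sq_eq_abs, meixnerNorm]

theorem polySeq_smul (a : ℝ) (p : ℝ[X]) : polySeq (a • p) = a • polySeq p := by
  funext k
  simp [polySeq]

/-- Homogeneity reduces to unit norm. Some finite `K` is needed beforehand: it bounds the set, so
that `sSup` is a true supremum, and it settles polynomials of norm zero. -/
theorem isLeast_markovBernsteinConst {n : ℕ} {c : ℝ} (hc : c ∈ Set.Ioo (0 : ℝ) 1) {K : ℝ}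
    (hK : ∀ p : ℝ[X], p.natDegree ≤ n →
      meixnerNorm c 1 (fwdDiff 1 (polySeq p)) ≤ K * meixnerNorm c 1 (polySeq p)) :
    IsLeast {C : ℝ | ∀ p : ℝ[X], p.natDegree ≤ n →
        meixnerNorm c 1 (fwdDiff 1 (polySeq p)) ≤ C * meixnerNorm c 1 (polySeq p)}
      (markovBernsteinConst n c 1) := by
  have hnormalize {p : ℝ[X]} (hp : p.natDegree ≤ n) (h0 : 0 < meixnerNorm c 1 (polySeq p)) :
      meixnerNorm c 1 (fwdDiff 1 (polySeq p)) / meixnerNorm c 1 (polySeq p) ∈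
        {r : ℝ | ∃ p : ℝ[X], p.natDegree ≤ n ∧ meixnerNorm c 1 (polySeq p) = 1 ∧
          r = meixnerNorm c 1 (fwdDiff 1 (polySeq p))} := by
    refine ⟨(meixnerNorm c 1 (polySeq p))⁻¹ • p, (natDegree_smul_le _ _).trans hp, ?_, ?_⟩
    · rw [polySeq_smul, meixnerNorm_smul, abs_of_pos (inv_pos.2 h0), inv_mul_cancel₀ h0.ne']
    · rw [polySeq_smul, fwdDiff_const_smul, meixnerNorm_smul, abs_of_pos (inv_pos.2 h0),
        div_eq_inv_mul]
  refine ⟨fun p hp => ?_, fun C hC => ?_⟩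
  · have hnonneg : 0 ≤ meixnerNorm c 1 (polySeq p) := Real.sqrt_nonneg _
    rcases hnonneg.eq_or_lt with h0 | h0
    · have h := hK p hp
      rwa [← h0, mul_zero] at h ⊢
    · rw [← div_le_iff₀ h0]
      refine le_csSup ⟨K, ?_⟩ (hnormalize hp h0)
      rintro r ⟨q, hq, hq1, rfl⟩
      simpa [hq1] using hK q hq
  -- The constant `1`, normalized, shows that the set is nonempty.
  · refine csSup_le ⟨_, hnormalize (p := 1) (by simp) ?_⟩ ?_
    · have h := meixnerForm_shift c hc 1 1
      simp only [one_comp, eval_one] at h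
      rw [meixnerNorm_polySeq c hc, Real.sqrt_pos]
      nlinarith [hc.2, meixnerForm_self_nonneg c hc 1, hc.1]
    · rintro r ⟨q, hq, hq1, rfl⟩
      simpa [hq1] using hC q hq

end

theorem theorem5p2 (n : ℕ) (hn : 2 ≤ n) (c : ℝ) (hc : c ∈ Set.Ioo (0 : ℝ) 1) :
    IsLeast {C : ℝ | ∀ p : Polynomial ℝ, p.natDegree ≤ n →
        meixnerNorm c 1 (fwdDiff 1 (polySeq p)) ≤ C * meixnerNorm c 1 (polySeq p)}
      (markovBernsteinConst n c 1) ∧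
    (1 + 1 / Real.sqrt c) /
        Real.sqrt (1 + 4 * Real.sqrt c / (1 - Real.sqrt c) ^ 2 *
          Real.sin (Real.pi / (2 * (n : ℝ))) ^ 2)
      ≤ markovBernsteinConst n c 1 ∧
    markovBernsteinConst n c 1 ≤
      (1 + 1 / Real.sqrt c) /
        Real.sqrt (1 + 2 * Real.sqrt c / ((1 - Real.sqrt c) ^ 2 * ((n : ℝ) * ((n : ℝ) + 1)))) := by
  have hs : √c ∈ Set.Ioo (0 : ℝ) 1 :=
    ⟨Real.sqrt_pos.2 hc.1, (Real.sqrt_lt' one_pos).2 (by simpa using hc.2)⟩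
  have hsq : √c ^ 2 = c := Real.sq_sqrt hc.1.le
  have hupper := fun (p : Polynomial ℝ) (hp : p.natDegree ≤ n) =>
    meixnerNorm_fwdDiff_le hs (by omega : 0 < n) hp
  obtain ⟨p, hp, hp0, hlower⟩ := exists_le_meixnerNorm_fwdDiff hs hn
  rw [hsq] at hupper hp0 hlower
  have hleast := isLeast_markovBernsteinConst hc hupper
  refine ⟨hleast, ?_, ?_⟩
  · rw [div_mul_eq_mul_div]
    exact le_of_mul_le_mul_right (hlower.trans (hleast.1 p hp)) hp0
  · rw [mul_comm ((1 - √c) ^ 2), ← div_div]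
    exact hleast.2 hupper
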